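/- Notation. All sets are subsets of $\mathbb N=\{0,1,2,\dots\}$. For a set $M$ and a finite set $u$ put $M/u=\{n\in M: n>i \text{ for all } i\in u\}$ and $M/n=M/\{n\}$. For a family $\mathcal F$ of finite sets put $\mathcal F_u=\{s \text{ finite}: u\cup s\in\mathcal F,\ i<j \text{ for all } i\in u,\ j\in s\}$ and $\mathcal F\upharpoonright M=\{s\in\mathcal F: s\subseteq M\}$. Uniform families. Let $S$ be infinite and $\mathcal F$ a family of finite subsets of $S$. $\mathcal F$ is $0$-uniform on $S$ iff $\mathcal F=\{\emptyset\}$; it is $(\beta+1)$-uniform on $S$ iff $\emptyset\notin\mathcal F$ and $\mathcal F_{\{n\}}$ is $\beta$-uniform on $S/n$ for all $n\in S$; for a limit ordinal $\alpha$ it is $\alpha$-uniform on $S$ iff $\emptyset\notin\mathcal F$ and there is a strictly increasing sequence of ordinals $(\alpha_n)_{n\in S}$ with supremum $\alpha$ such that $\mathcal F_{\{n\}}$ is $\alpha_n$-uniform on $S/n$ for all $n\in S$. A uniform family $\mathcal F$ on a final segment of $\mathbb N$ is given the order topology of the lexicographic order $s<_{lex}t\iff\min(s\triangle t)\in s$,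 and $\mathcal F\upharpoonright M$ the subspace topology. Adequate sets. Let $\mathcal F$ be $\alpha$-uniform on a final segment $S$ of $\mathbb N$ with $\alpha\ge2$, let $t^{\mathcal F}_n$ be the element of $\mathcal F$ that is an initial segment of $\{n,n+1,\dots\}$, and let $M$ be infinite. By recursion on $\alpha$ define $M(\mathcal F)\subseteq M$ and when $M$ is $\mathcal F$-adequate: (i) if $\alpha=2$, $M(\mathcal F)=\{n\in M: t^{\mathcal F}_{n+1}\subseteq M\}$, and $M$ is $\mathcal F$-adequate iff $M(\mathcal F)\ne\emptyset$; (ii) if $\alpha=\beta+1$ with $\beta\ge2$, $M(\mathcal F)$ is the set of $n\in M$ such that $t^{\mathcal F}_{n+1}\subseteq M$, $M/n$ is $\mathcal F_{\{n\}}$-adequate and $(M/n)(\mathcal F_{\{n\}})$ is infinite, and $M$ is $\mathcal F$-adequate iff $M(\mathcal F)\ne\emptyset$; (iii) if $\alpha$ is a limit and $(\alpha_n)_{n\in S}$ is as in the definition of an $\alpha$-uniform family, $M(\mathcal F)=M$, and $M$ is $\mathcal F$-adequate iff for every $n\in S$ there is a nonempty finite $v\subseteq M$ such that $\mathcal F_v$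 is $\gamma$-uniform on $S/v$ for some $\gamma\ge\alpha_n$ and $M/v$ is $\mathcal F_v$-adequate. Statement. The Schreier barrier $\mathcal S=\{t \text{ finite nonempty}: |t|=\min(t)+1\}$ is $\omega$-uniform on $\mathbb N$. Moreover, if $\mathcal F$ is an $\omega$-uniform family on a final segment of $\mathbb N$ and $M\subseteq\mathbb N$ is infinite, then the space $\mathcal F\upharpoonright M$ contains a subspace homeomorphic to $\mathcal F$ if and only if $M$ is $\mathcal F$-adequate, and $M$ is $\mathcal F$-adequate if and only if $M$ contains arbitrarily long intervals of consecutive integers. -/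

import Mathlib

open Set
open scoped Ordinal

namespace UniformFamily

/-- `M / u`: the elements of `M` above all elements of the finite set `u`
(so `M / ∅ = M`, and `M / k` is `after M {k}`). -/
def after (M : Set ℕ) (u : Finset ℕ) : Set ℕ := {n | n ∈ M ∧ ∀ i ∈ u, i < n}

/-- `F_u`: the finite sets `s` with `max u < min s` and `u ∪ s ∈ F`. -/
def tail (F : Set (Finset ℕ)) (u : Finset ℕ) : Set (Finset ℕ) :=
  {s | u ∪ s ∈ F ∧ ∀ i ∈ u, ∀ j ∈ s, i < j}

/-- `IsUniform α F S`: `F` is an `α`-uniform family of finite subsets of the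
(infinite) set `S`. -/
inductive IsUniform : Ordinal.{0} → Set (Finset ℕ) → Set ℕ → Prop
  | zero (S : Set ℕ) : IsUniform 0 {∅} S
  | succ (β : Ordinal.{0}) (F : Set (Finset ℕ)) (S : Set ℕ)
      (sub : ∀ s ∈ F, (s : Set ℕ) ⊆ S) (ne : ∅ ∉ F)
      (h : ∀ n ∈ S, IsUniform β (tail F {n}) (after S {n})) :
      IsUniform (β + 1) F S
  | limit (α : Ordinal.{0}) (F : Set (Finset ℕ)) (S : Set ℕ)
      (lim : Order.IsSuccLimit α)
      (sub : ∀ s ∈ F, (s : Set ℕ) ⊆ S) (ne : ∅ ∉ F)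
      (a : ℕ → Ordinal.{0}) (mono : StrictMonoOn a S) (lub : IsLUB (a '' S) α)
      (h : ∀ n ∈ S, IsUniform (a n) (tail F {n}) (after S {n})) :
      IsUniform α F S

/-- The Schreier barrier: the nonempty finite `t` with `|t| = min t + 1`. -/
def schreierBarrier : Set (Finset ℕ) := {t | ∃ h : t.Nonempty, t.card = t.min' h + 1}

/-- `s ⊑ A`: `s` is the intersection of `A` with some `{0, …, n}`. -/
def IsInitialSegment (s : Finset ℕ) (A : Set ℕ) : Prop := ∃ n, (s : Set ℕ) = A ∩ Set.Iic n

/-- `t_n^F ⊆ M`, where `t_n^F` is the element of the front `F` which is an initial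
segment of `{n, n+1, …}`. -/
def FirstSubset (F : Set (Finset ℕ)) (n : ℕ) (M : Set ℕ) : Prop :=
  ∃ t ∈ F, IsInitialSegment t (Set.Ici n) ∧ (t : Set ℕ) ⊆ M

mutual

/-- The set `M(F)`, for `F` an `α`-uniform family on `S` with `α ≥ 2`. -/
def core (α : Ordinal.{0}) (F : Set (Finset ℕ)) (S M : Set ℕ) : Set ℕ :=
  {n | n ∈ M ∧
    ((α = 2 ∧ FirstSubset F (n + 1) M) ∨
     (∃ β : Ordinal.{0}, ∃ _ : α = β + 1, 2 ≤ β ∧ FirstSubset F (n + 1) M ∧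
        IsAdequate β (tail F {n}) (after S {n}) (after M {n}) ∧
        (core β (tail F {n}) (after S {n}) (after M {n})).Infinite) ∨
     Order.IsSuccLimit α)}
termination_by (α, 0)
decreasing_by
  all_goals
    apply Prod.Lex.left
    subst_vars
    exact lt_add_of_pos_right _ zero_lt_one

/-- `M` is `F`-adequate, for `F` an `α`-uniform family on `S` with `α ≥ 2`.
In the limit case `γ < α` holds automatically, because `v` is nonempty. -/
def IsAdequate (α : Ordinal.{0}) (F : Set (Finset ℕ)) (S M : Set ℕ) : Prop :=
  (¬ Order.IsSuccLimit α ∧ (core α F S M).Nonempty) ∨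
  (Order.IsSuccLimit α ∧
    ∃ a : ℕ → Ordinal.{0}, StrictMonoOn a S ∧ IsLUB (a '' S) α ∧
      (∀ n ∈ S, IsUniform (a n) (tail F {n}) (after S {n})) ∧
      ∀ n ∈ S, ∃ v : Finset ℕ, v.Nonempty ∧ (v : Set ℕ) ⊆ M ∧
        ∃ γ : Ordinal.{0}, ∃ _ : γ < α, a n ≤ γ ∧ IsUniform γ (tail F v) (after S v) ∧
          IsAdequate γ (tail F v) (after S v) (after M v))
termination_by (α, 1)
decreasing_by
  · exact Prod.Lex.right _ zero_lt_one
  · apply Prod.Lex.left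
    assumption

end

/-- `s <_lex t`: the least element of the symmetric difference of `s` and `t` lies in `s`. -/
def LexLT (s t : Finset ℕ) : Prop := ∃ m, m ∈ s ∧ m ∉ t ∧ ∀ j < m, (j ∈ s ↔ j ∈ t)

theorem LexLT.irrefl (s : Finset ℕ) : ¬ LexLT s s := fun ⟨_, h, h', _⟩ => h' h

theorem LexLT.trans {s t u : Finset ℕ} (h : LexLT s t) (h' : LexLT t u) : LexLT s u := by
  obtain ⟨m, h1, h2, h3⟩ := h
  obtain ⟨n, k1, k2, k3⟩ := h'
  rcases lt_trichotomy m n with hmn | rfl | hmn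
  · exact ⟨m, h1, fun hu => h2 ((k3 m hmn).2 hu),
      fun j hj => (h3 j hj).trans (k3 j (hj.trans hmn))⟩
  · exact absurd k1 h2
  · exact ⟨n, (h3 n hmn).2 k1, k2, fun j hj => (h3 j (hj.trans hmn)).trans (k3 j hj)⟩

/-- The family `F` as a topological space: the underlying type. -/
def Space (F : Set (Finset ℕ)) : Type := {s : Finset ℕ // s ∈ F}

/-- The lexicographic order on `F`. -/
instance (F : Set (Finset ℕ)) : Preorder (Space F) where
  lt s t := LexLT s.1 t.1
  le s t := s = t ∨ LexLT s.1 t.1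
  le_refl s := Or.inl rfl
  le_trans s t u := by
    rintro (rfl | h) (rfl | h')
    · exact Or.inl rfl
    · exact Or.inr h'
    · exact Or.inr h
    · exact Or.inr (h.trans h')
  lt_iff_le_not_ge s t := by
    constructor
    · intro h
      refine ⟨Or.inr h, ?_⟩
      rintro (rfl | h')
      · exact LexLT.irrefl _ h
      · exact LexLT.irrefl _ (h.trans h')
    · rintro ⟨rfl | h, h'⟩
      · exact absurd (Or.inl rfl) h'
      · exact h

/-- `F` carries the order topology of the lexicographic order. -/
instance (F : Set (Finset ℕ)) : TopologicalSpace (Space F) := Preorder.topology (Space F)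

/-- `F ↾ M`, as a subset (with the subspace topology) of the space `F`. -/
def restrict (F : Set (Finset ℕ)) (M : Set ℕ) : Set (Space F) := {s | (s.1 : Set ℕ) ⊆ M}

/-- The subspace `F ↾ M` contains a topological copy of `F`. -/
def ContainsCopy (F : Set (Finset ℕ)) (M : Set ℕ) : Prop :=
  ∃ X : Set (Space F), X ⊆ restrict F M ∧ Nonempty (Space F ≃ₜ X)

/-- `M` contains arbitrarily long intervals of consecutive integers. -/
def HasLongIntervals (M : Set ℕ) : Prop := ∀ l : ℕ, ∃ n : ℕ, ∀ i < l, n + i ∈ M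

end UniformFamily

namespace UniformFamily

-- A uniform family of finite rank `d` on `S` consists of all `d`-element subsets of `S`. Hence an
-- `ω`-uniform family on `[k, ∞)` is given by a strictly increasing `a`: its members are the finite
-- sets with least element `n ≥ k` and `a n + 1` elements (`IsUniform.exists_eq_omegaFamily`). For
-- finite rank `d`, the set `t_{n+1}` is the interval of length `d` starting at `n + 1`, so adequacy
-- at `ω` asks precisely for arbitrarily long intervals in `M`.
--
-- For the topology, consider nodes, the nonempty initial segments of members. In the lexicographic
-- order a proper end-extension of `p` lies below `p`, and each node `p` has a least member of the
-- family above it, obtained by replacing `max p = c` by an interval starting at `c + 1`. This is an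
-- order isomorphism from the nodes onto the family without its least member. If `p` is itself a
-- member, its supremum is isolated; otherwise it is the limit from below of the suprema of `p ∪
-- {i}` as `i → ∞`. The Cantor–Bendixson rank is thus governed by how many elements `p` still lacks,
-- which is also visible as the length of the final interval of the supremum.
--
-- A copy of the family inside `F ↾ M` therefore forces long intervals: every finite derivative of
-- the family is nonempty, injective continuous maps preserve derivatives, and a point of the `j`-th
-- derivative ends in an interval of length `j + 1`. Conversely, given long intervals, nodes are
-- mapped to nodes inside `M` whose last element starts an interval of `M` long enough to hold the
-- one appearing in the supremum; passing to suprema gives the embedding.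

theorem mem_tail_singleton {F : Set (Finset ℕ)} {n : ℕ} {s : Finset ℕ} :
    s ∈ tail F {n} ↔ insert n s ∈ F ∧ ∀ j ∈ s, n < j := by
  simp [tail]

theorem mem_after_singleton {M : Set ℕ} {n i : ℕ} : i ∈ after M {n} ↔ i ∈ M ∧ n < i := by
  simp [after]

-- Uniform families of finite rank

/-- The finite subsets of `S` with `d` elements. -/
def cardFamily (d : ℕ) (S : Set ℕ) : Set (Finset ℕ) := {s | (s : Set ℕ) ⊆ S ∧ s.card = d}

theorem exists_least_insert {s : Finset ℕ} (hs : s.Nonempty) :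
    ∃ n r, s = insert n r ∧ ∀ i ∈ r, n < i := by
  refine ⟨s.min' hs, s.erase (s.min' hs), (Finset.insert_erase (s.min'_mem hs)).symm, ?_⟩
  intro i hi
  exact Finset.min'_lt_of_mem_erase_min' s hs hi

theorem tail_cardFamily (d : ℕ) {S : Set ℕ} {n : ℕ} (hn : n ∈ S) :
    tail (cardFamily (d + 1) S) {n} = cardFamily d (after S {n}) := by
  ext s
  rw [mem_tail_singleton]
  constructor
  · rintro ⟨⟨h1, h2⟩, h3⟩
    have hns : n ∉ s := fun h => lt_irrefl _ (h3 n h)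
    rw [Finset.card_insert_of_notMem hns] at h2
    refine ⟨fun i hi => mem_after_singleton.2 ⟨h1 (by simp at hi ⊢; exact Or.inr hi), h3 i hi⟩, ?_⟩
    omega
  · rintro ⟨h1, h2⟩
    have h3 : ∀ j ∈ s, n < j := fun j hj => (mem_after_singleton.1 (h1 hj)).2
    have hns : n ∉ s := fun h => lt_irrefl _ (h3 n h)
    refine ⟨⟨?_, by rw [Finset.card_insert_of_notMem hns, h2]⟩, h3⟩
    intro i hi
    rcases Finset.mem_insert.1 hi with rfl | hi
    · exact hn
    · exact (h1 hi).1

theorem isUniform_cardFamily (d : ℕ) (S : Set ℕ) : IsUniform d (cardFamily d S) S := by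
  induction d generalizing S with
  | zero =>
    have : cardFamily 0 S = {∅} := by
      ext s
      simp only [cardFamily, mem_ofPred_eq, Finset.card_eq_zero, mem_singleton_iff]
      exact ⟨fun h => h.2, by rintro rfl; simp⟩
    rw [this]
    exact_mod_cast IsUniform.zero S
  | succ d ih =>
    push_cast
    refine IsUniform.succ _ _ _ (fun s hs => hs.1) (fun h => by simpa using h.2) fun n hn => ?_
    rw [tail_cardFamily d hn]
    exact ih _

/-- Removing the least element reduces the rank by one, so induction leaves no freedom at finite
rank. -/
theorem IsUniform.eq_cardFamily {α : Ordinal.{0}} {F : Set (Finset ℕ)} {S : Set ℕ}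
    (h : IsUniform α F S) : ∀ d : ℕ, α = d → F = cardFamily d S := by
  induction h with
  | zero S =>
    intro d hd
    have : d = 0 := by exact_mod_cast hd.symm
    subst this
    ext s
    simp only [cardFamily, mem_ofPred_eq, Finset.card_eq_zero, mem_singleton_iff]
    exact ⟨by rintro rfl; simp, fun h => h.2⟩
  | succ β F S sub ne h ih =>
    intro d hd
    cases d with
    | zero => simp at hd
    | succ d =>
      have hβ : β = d := by
        push_cast at hd
        exact Order.succ_injective (by simpa using hd)
      ext s
      constructor
      · intro hs
        have hne : s.Nonempty := Finset.nonempty_iff_ne_empty.2 fun h => ne (h ▸ hs)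
        obtain ⟨n, r, rfl, hr⟩ := exists_least_insert hne
        have hn : n ∈ S := sub _ hs (by simp)
        have hrt : r ∈ tail F {n} := mem_tail_singleton.2 ⟨hs, hr⟩
        rw [ih n hn d hβ, ← tail_cardFamily d hn] at hrt
        exact (mem_tail_singleton.1 hrt).1
      · intro hs
        have hne : s.Nonempty := Finset.card_pos.1 (by rw [hs.2]; omega)
        obtain ⟨n, r, rfl, hr⟩ := exists_least_insert hne
        have hn : n ∈ S := hs.1 (by simp)
        have hrt : r ∈ tail (cardFamily (d + 1) S) {n} := mem_tail_singleton.2 ⟨hs, hr⟩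
        rw [tail_cardFamily d hn, ← ih n hn d hβ] at hrt
        exact (mem_tail_singleton.1 hrt).1
  | limit α F S lim =>
    intro d hd
    subst hd
    exact absurd lim (Order.not_isSuccLimit_natCast d)

-- Classification of `ω`-uniform families

/-- The finite sets with least element `n ≥ k` that have `a n + 1` elements. -/
def omegaFamily (k : ℕ) (a : ℕ → ℕ) : Set (Finset ℕ) :=
  {s | ∃ n ∈ s, (∀ i ∈ s, n ≤ i) ∧ k ≤ n ∧ s.card = a n + 1}

theorem insert_mem_omegaFamily {k : ℕ} {a : ℕ → ℕ} {n : ℕ} {r : Finset ℕ} (hr : ∀ i ∈ r, n < i) :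
    insert n r ∈ omegaFamily k a ↔ k ≤ n ∧ r.card = a n := by
  have hnr : n ∉ r := fun h => lt_irrefl _ (hr n h)
  constructor
  · rintro ⟨m, hm, hmin, hk, hc⟩
    have : m = n := by
      apply le_antisymm (hmin n (by simp))
      rcases Finset.mem_insert.1 hm with rfl | h
      · exact le_rfl
      · exact (hr m h).le
    subst this
    rw [Finset.card_insert_of_notMem hnr] at hc
    exact ⟨hk, by omega⟩
  · rintro ⟨hk, hc⟩
    refine ⟨n, by simp, ?_, hk, by rw [Finset.card_insert_of_notMem hnr, hc]⟩
    intro i hi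
    rcases Finset.mem_insert.1 hi with rfl | h
    · exact le_rfl
    · exact (hr i h).le

theorem IsUniform.exists_eq_omegaFamily {k : ℕ} {F : Set (Finset ℕ)}
    (h : IsUniform ω F (Ici k)) :
    ∃ a : ℕ → ℕ, StrictMonoOn a (Ici k) ∧ F = omegaFamily k a := by
  generalize hα : (ω : Ordinal.{0}) = α at h
  generalize hS : Ici k = S at h
  cases h with
  | zero => exact absurd hα Ordinal.omega0_ne_zero
  | succ β _ _ sub ne h =>
    have := Ordinal.isSuccLimit_omega0
    rw [hα] at this
    exact absurd this (by simp)
  | limit _ _ _ lim sub ne a mono lub h =>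
    subst hS
    subst hα
    -- Strict monotonicity keeps each rank strictly below the supremum, hence finite.
    have hlt : ∀ n ∈ Ici k, a n < ω := fun n hn =>
      (mono hn (mem_Ici.2 (le_trans hn (Nat.le_succ n))) (Nat.lt_succ_self n)).trans_le
        (lub.1 ⟨n + 1, mem_Ici.2 (le_trans hn (Nat.le_succ n)), rfl⟩)
    have hex : ∀ n, ∃ m : ℕ, n ∈ Ici k → a n = m := by
      intro n
      by_cases hn : n ∈ Ici k
      · obtain ⟨m, hm⟩ := Ordinal.lt_omega0.1 (hlt n hn)
        exact ⟨m, fun _ => hm⟩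
      · exact ⟨0, fun h => absurd h hn⟩
    choose b hb using hex
    refine ⟨b, ?_, ?_⟩
    · intro m hm n hn hmn
      have := mono hm hn hmn
      rw [hb m hm, hb n hn] at this
      exact_mod_cast this
    · ext s
      constructor
      · intro hs
        obtain ⟨n, r, rfl, hr⟩ :=
          exists_least_insert (Finset.nonempty_iff_ne_empty.2 fun h => ne (h ▸ hs))
        have hn : n ∈ Ici k := sub _ hs (by simp)
        have hrt : r ∈ tail F {n} := mem_tail_singleton.2 ⟨hs, hr⟩
        rw [(h n hn).eq_cardFamily (b n) (hb n hn)] at hrt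
        exact (insert_mem_omegaFamily hr).2 ⟨hn, hrt.2⟩
      · intro hs
        obtain ⟨n, r, rfl, hr⟩ : ∃ n r, s = insert n r ∧ ∀ i ∈ r, n < i :=
          exists_least_insert ⟨_, hs.choose_spec.1⟩
        obtain ⟨hn, hc⟩ := (insert_mem_omegaFamily hr).1 hs
        have hrt : r ∈ tail F {n} := by
          rw [(h n hn).eq_cardFamily (b n) (hb n hn)]
          exact ⟨fun i hi => mem_after_singleton.2 ⟨mem_Ici.2 (le_trans hn (hr i hi).le), hr i hi⟩, hc⟩
        exact (mem_tail_singleton.1 hrt).1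

theorem tail_omegaFamily {k : ℕ} {a : ℕ → ℕ} {n : ℕ} (hn : k ≤ n) :
    tail (omegaFamily k a) {n} = cardFamily (a n) (after (Ici k) {n}) := by
  ext s
  rw [mem_tail_singleton]
  constructor
  · rintro ⟨h1, h2⟩
    exact ⟨fun i hi => mem_after_singleton.2 ⟨mem_Ici.2 (le_trans hn (h2 i hi).le), h2 i hi⟩,
      ((insert_mem_omegaFamily h2).1 h1).2⟩
  · rintro ⟨h1, h2⟩
    have h3 : ∀ i ∈ s, n < i := fun i hi => (mem_after_singleton.1 (h1 hi)).2
    exact ⟨(insert_mem_omegaFamily h3).2 ⟨hn, h2⟩, h3⟩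

theorem isLUB_natCast_image {k : ℕ} {a : ℕ → ℕ} (ha : StrictMonoOn a (Ici k)) :
    IsLUB ((fun n => (a n : Ordinal.{0})) '' Ici k) ω := by
  have key : ∀ n, n ≤ a (k + n) := by
    intro n
    induction n with
    | zero => exact Nat.zero_le _
    | succ n ih =>
      exact ih.trans_lt (ha (mem_Ici.2 (by omega)) (mem_Ici.2 (by omega)) (by omega))
  constructor
  · rintro _ ⟨n, _, rfl⟩
    exact (Ordinal.natCast_lt_omega0 _).le
  · intro o ho
    refine Ordinal.omega0_le.2 fun n => ?_
    exact le_trans (Nat.cast_le.2 (key n)) (ho ⟨k + n, mem_Ici.2 (by omega), rfl⟩)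

theorem isUniform_tail_omegaFamily {k : ℕ} {a : ℕ → ℕ} {n : ℕ} (hn : k ≤ n) :
    IsUniform (a n) (tail (omegaFamily k a) {n}) (after (Ici k) {n}) := by
  rw [tail_omegaFamily hn]
  exact isUniform_cardFamily _ _

theorem isUniform_omegaFamily {k : ℕ} {a : ℕ → ℕ} (ha : StrictMonoOn a (Ici k)) :
    IsUniform ω (omegaFamily k a) (Ici k) := by
  refine IsUniform.limit _ _ _ Ordinal.isSuccLimit_omega0 ?_ ?_ (fun n => (a n : Ordinal.{0})) ?_
    (isLUB_natCast_image ha) fun n hn => isUniform_tail_omegaFamily hn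
  · rintro s ⟨n, _, h1, h2, _⟩ i hi
    exact mem_Ici.2 (h2.trans (h1 i hi))
  · rintro ⟨n, hn, _⟩
    simp at hn
  · intro m hm n hn hmn
    exact Nat.cast_lt.2 (ha hm hn hmn)

theorem schreierBarrier_eq : schreierBarrier = omegaFamily 0 id := by
  ext s
  constructor
  · rintro ⟨h, hc⟩
    exact ⟨s.min' h, s.min'_mem h, fun i hi => s.min'_le i hi, Nat.zero_le _, hc⟩
  · rintro ⟨n, hn, hmin, _, hc⟩
    have : s.min' ⟨n, hn⟩ = n :=
      le_antisymm (s.min'_le n hn) (hmin _ (s.min'_mem _))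
    exact ⟨⟨n, hn⟩, by rw [this, hc]; rfl⟩

-- Adequacy and long intervals

theorem HasLongIntervals.after {M : Set ℕ} (hM : HasLongIntervals M) (n : ℕ) :
    HasLongIntervals (after M {n}) := by
  intro l
  obtain ⟨m, hm⟩ := hM (n + 1 + l)
  refine ⟨m + (n + 1), fun i hi => mem_after_singleton.2 ⟨?_, by omega⟩⟩
  have := hm (n + 1 + i) (by omega)
  rwa [← add_assoc] at this

theorem HasLongIntervals.infinite_setOf {M : Set ℕ} (hM : HasLongIntervals M) (d : ℕ) :
    {n | ∀ i ≤ d, n + i ∈ M}.Infinite := by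
  rw [Set.infinite_iff_exists_gt]
  intro b
  obtain ⟨n, hn⟩ := hM.after b (d + 1)
  exact ⟨n, fun i hi => (hn i (by omega)).1, (mem_after_singleton.1 (hn 0 (by omega))).2⟩

theorem firstSubset_cardFamily {d n : ℕ} {S M : Set ℕ} (hMS : M ⊆ S)
    (h : ∀ i ≤ d, n + i ∈ M) : FirstSubset (cardFamily d S) (n + 1) M := by
  have hsub : ((Finset.Icc (n + 1) (n + d) : Finset ℕ) : Set ℕ) ⊆ M := by
    intro i hi
    simp only [Finset.coe_Icc, mem_Icc] at hi
    have := h (i - n) (by omega)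
    rwa [show n + (i - n) = i by omega] at this
  refine ⟨Finset.Icc (n + 1) (n + d), ⟨hsub.trans hMS, by simp⟩, ⟨n + d, ?_⟩, hsub⟩
  ext i
  simp

/-- Every `n` starting an interval of `d + 1` elements of `M` qualifies, because long intervals
survive the passage to `M / n`. Infinitude is carried through the induction since the successor
clause demands it. -/
theorem HasLongIntervals.core_infinite {d : ℕ} (hd : 2 ≤ d) {S M : Set ℕ} (hMS : M ⊆ S)
    (hM : HasLongIntervals M) : (core d (cardFamily d S) S M).Infinite := by
  induction d, hd using Nat.le_induction generalizing S M with
  | base =>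
    refine (hM.infinite_setOf 2).mono fun n hn => ?_
    rw [core]
    exact ⟨hn 0 (by omega), Or.inl ⟨by norm_num, firstSubset_cardFamily hMS hn⟩⟩
  | succ d hd ih =>
    refine (hM.infinite_setOf (d + 1)).mono fun n hn => ?_
    rw [core]
    have hnM : n ∈ M := hn 0 (by omega)
    have hinf := ih (S := UniformFamily.after S {n}) (fun i hi => ⟨hMS hi.1, hi.2⟩) (hM.after n)
    refine ⟨hnM, Or.inr (Or.inl ?_)⟩
    rw [tail_cardFamily d (hMS hnM)]
    refine ⟨d, by push_cast; rfl, by exact_mod_cast hd,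
      firstSubset_cardFamily hMS hn, ?_, hinf⟩
    rw [IsAdequate]
    exact Or.inl ⟨Order.not_isSuccLimit_natCast d, hinf.nonempty⟩

theorem HasLongIntervals.isAdequate {k : ℕ} {a : ℕ → ℕ} (ha : StrictMonoOn a (Ici k)) {M : Set ℕ}
    (hM : HasLongIntervals M) : IsAdequate ω (omegaFamily k a) (Ici k) M := by
  rw [IsAdequate]
  refine Or.inr ⟨Ordinal.isSuccLimit_omega0, fun n => (a n : Ordinal.{0}), ?_,
    isLUB_natCast_image ha, fun n hn => isUniform_tail_omegaFamily hn, ?_⟩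
  · intro m hm n hn hmn
    exact Nat.cast_lt.2 (ha hm hn hmn)
  · intro n hn
    have hn : k ≤ n := hn
    -- Going beyond `n + 1` forces `a m ≥ 2`, the least rank at which adequacy is meaningful.
    obtain ⟨m, hm, hnm⟩ := (hM.infinite_setOf 0).exists_gt (n + 2)
    have hmM : m ∈ M := hm 0 le_rfl
    have hkm : k ≤ m := by omega
    have h1 : a n < a (n + 1) := ha (mem_Ici.2 hn) (mem_Ici.2 (by omega)) (by omega)
    have h2 : a (n + 1) < a m := ha (mem_Ici.2 (by omega)) (mem_Ici.2 (by omega)) (by omega)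
    refine ⟨{m}, by simp, by simpa using hmM, a m, Ordinal.natCast_lt_omega0 _,
      Nat.cast_le.2 (h1.trans h2).le, isUniform_tail_omegaFamily hkm, ?_⟩
    rw [IsAdequate, tail_omegaFamily hkm]
    refine Or.inl ⟨Order.not_isSuccLimit_natCast _, ?_⟩
    have hMk : HasLongIntervals (UniformFamily.after M {m}) := hM.after m
    refine (hMk.core_infinite (d := a m) (by omega) ?_).nonempty
    intro i hi
    have := (mem_after_singleton.1 hi).2
    exact mem_after_singleton.2 ⟨mem_Ici.2 (by omega), this⟩

theorem firstSubset_of_mem_core {d n : ℕ} {F : Set (Finset ℕ)} {S M : Set ℕ}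
    (hn : n ∈ core d F S M) : FirstSubset F (n + 1) M := by
  rw [core] at hn
  rcases hn.2 with h | ⟨β, -, -, h, -⟩ | h
  · exact h.2
  · exact h
  · exact absurd h (Order.not_isSuccLimit_natCast d)

theorem IsAdequate.hasLongIntervals {k : ℕ} {F : Set (Finset ℕ)} {M : Set ℕ}
    (h : IsAdequate ω F (Ici k) M) : HasLongIntervals M := by
  rw [IsAdequate] at h
  obtain ⟨h, -⟩ | ⟨-, a, mono, lub, -, h⟩ := h
  · exact absurd Ordinal.isSuccLimit_omega0 h
  intro l
  obtain ⟨_, ⟨n, hn, rfl⟩, hln⟩ := (lt_isLUB_iff lub).1 (Ordinal.natCast_lt_omega0 l)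
  obtain ⟨v, -, -, γ, hγ, hnγ, hu, had⟩ := h n hn
  obtain ⟨d, rfl⟩ := Ordinal.lt_omega0.1 hγ
  have hld : l < d := by exact_mod_cast hln.trans_le hnγ
  rw [IsAdequate] at had
  obtain ⟨-, m, hm⟩ | ⟨h, -⟩ := had
  · obtain ⟨t, htF, ⟨x, hx⟩, htM⟩ := firstSubset_of_mem_core hm
    rw [hu.eq_cardFamily d rfl] at htF
    have ht : t = Finset.Icc (m + 1) x := by
      apply Finset.coe_injective
      rw [hx]
      ext i
      simp
    have hc := htF.2
    rw [ht, Nat.card_Icc] at hc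
    refine ⟨m + 1, fun i hi => (htM ?_).1⟩
    rw [ht]
    simp only [Finset.coe_Icc, mem_Icc]
    omega
  · exact absurd h (Order.not_isSuccLimit_natCast d)

-- The lexicographic order and suprema of nodes

theorem LexLT.trichotomy (s t : Finset ℕ) : LexLT s t ∨ s = t ∨ LexLT t s := by
  classical
  by_cases h : s = t
  · exact Or.inr (Or.inl h)
  have hex : ∃ m, ¬ (m ∈ s ↔ m ∈ t) := by
    by_contra! hc
    exact h (Finset.ext hc)
  have hmin : ∀ j < Nat.find hex, (j ∈ s ↔ j ∈ t) := fun j hj => not_not.1 (Nat.find_min hex hj)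
  have hm := Nat.find_spec hex
  by_cases hs : Nat.find hex ∈ s
  · exact Or.inl ⟨_, hs, fun ht => hm ⟨fun _ => ht, fun _ => hs⟩, hmin⟩
  · refine Or.inr (Or.inr ⟨_, ?_, hs, fun j hj => (hmin j hj).symm⟩)
    by_contra ht
    exact hm ⟨fun h => absurd h hs, fun h => absurd h ht⟩

theorem LexLT.not_gt {s t : Finset ℕ} (h : LexLT s t) : ¬ LexLT t s :=
  fun h' => LexLT.irrefl _ (h.trans h')

/-- The lexicographic order on a family of finite sets, as a linear order. -/
noncomputable instance (F : Set (Finset ℕ)) : LinearOrder (Space F) where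
  le_antisymm s t h h' := by
    rcases h with h | h
    · exact h
    · rcases h' with h' | h'
      · exact h'.symm
      · exact absurd h' h.not_gt
  le_total s t := by
    rcases LexLT.trichotomy s.1 t.1 with h | h | h
    · exact Or.inl (Or.inr h)
    · exact Or.inl (Or.inl (Subtype.ext h))
    · exact Or.inr (Or.inr h)
  toDecidableLE := Classical.decRel _

instance (F : Set (Finset ℕ)) : OrderTopology (Space F) := ⟨rfl⟩

/-- A set whose part above `b` is an interval starting at `b` is the lexicographically least
member of the family among those that agree with it below `b`. -/
theorem eq_or_lexLT_of_interval {k : ℕ} {a : ℕ → ℕ} {s u : Finset ℕ} (hs : s ∈ omegaFamily k a)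
    (hu : u ∈ omegaFamily k a) {b m : ℕ} (hb : ∀ j < b, (j ∈ s ↔ j ∈ u))
    (hm : ∀ j, b ≤ j → (j ∈ s ↔ j ≤ m)) : s = u ∨ LexLT s u := by
  classical
  by_cases hsub : s ⊆ u
  · left
    obtain ⟨n, hn, hn', -, hc⟩ := hs
    obtain ⟨l, hl, hl', -, hc'⟩ := hu
    have hln : l ≤ n := hl' n (hsub hn)
    have : l = n := by
      by_contra hne
      have hls : l ∉ s := fun h => hne (le_antisymm hln (hn' l h))
      have hbl : b ≤ l := by
        by_contra hlt
        exact hls ((hb l (by omega)).2 hl)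
      rw [hm l hbl] at hls
      exact hls (hln.trans ((hm n (hbl.trans hln)).1 hn))
    subst this
    exact Finset.eq_of_subset_of_card_le hsub (by omega)
  · right
    have hex : ∃ y, y ∈ s ∧ y ∉ u := Finset.not_subset.1 hsub
    obtain ⟨hy, hyu⟩ := Nat.find_spec hex
    have hmin : ∀ j < Nat.find hex, j ∈ s → j ∈ u := fun j hj hjs => by
      by_contra hju
      exact Nat.find_min hex hj ⟨hjs, hju⟩
    generalize Nat.find hex = y at *
    refine ⟨y, hy, hyu, fun j hj => ⟨hmin j hj, fun hju => ?_⟩⟩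
    rcases lt_or_ge j b with h | h
    · exact (hb j h).2 hju
    · exact (hm j h).2 (hj.le.trans ((hm y (h.trans hj.le)).1 hy))

/-- `s` is obtained from `p` by replacing the largest element `c` of `p` by an interval
starting at `c + 1`. If `p` is a nonempty initial segment of a member of an `ω`-uniform family
that contains `s`, then `s` is the least member of the family above all those extending `p`. -/
def IsLexSup (p s : Finset ℕ) : Prop :=
  ∃ q c m, (∀ i ∈ q, i < c) ∧ c < m ∧ p = insert c q ∧ s = q ∪ Finset.Icc (c + 1) m

/-- The nonempty initial segments of members of `omegaFamily k a`. -/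
def IsNode (k : ℕ) (a : ℕ → ℕ) (p : Finset ℕ) : Prop :=
  ∃ n ∈ p, (∀ i ∈ p, n ≤ i) ∧ k ≤ n ∧ p.card ≤ a n + 1

theorem isNode_of_mem {k : ℕ} {a : ℕ → ℕ} {p : Finset ℕ} (hp : p ∈ omegaFamily k a) :
    IsNode k a p := by
  obtain ⟨n, h1, h2, h3, h4⟩ := hp
  exact ⟨n, h1, h2, h3, h4.le⟩

theorem exists_insert_greatest {p : Finset ℕ} (hp : p.Nonempty) :
    ∃ c q, p = insert c q ∧ ∀ i ∈ q, i < c := by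
  refine ⟨p.max' hp, p.erase (p.max' hp), (Finset.insert_erase (p.max'_mem hp)).symm, ?_⟩
  intro i hi
  exact Finset.lt_max'_of_mem_erase_max' p hp hi

theorem insert_greatest_inj {c c' : ℕ} {q q' : Finset ℕ} (hq : ∀ i ∈ q, i < c)
    (hq' : ∀ i ∈ q', i < c') (h : insert c q = insert c' q') : c = c' ∧ q = q' := by
  have h1 : c ∈ insert c' q' := h ▸ Finset.mem_insert_self c q
  have h2 : c' ∈ insert c q := h ▸ Finset.mem_insert_self c' q'
  have hc : c = c' := by
    rcases Finset.mem_insert.1 h1 with h1 | h1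
    · exact h1
    rcases Finset.mem_insert.1 h2 with h2 | h2
    · exact h2.symm
    exact absurd (hq' _ h1) (hq _ h2).not_gt
  subst hc
  refine ⟨rfl, ?_⟩
  have hcq : c ∉ q := fun h => lt_irrefl _ (hq c h)
  have hcq' : c ∉ q' := fun h => lt_irrefl _ (hq' c h)
  rw [← Finset.erase_insert hcq, h, Finset.erase_insert hcq']

theorem IsNode.exists_isLexSup {k : ℕ} {a : ℕ → ℕ} {p : Finset ℕ} (hp : IsNode k a p) :
    ∃ s ∈ omegaFamily k a, IsLexSup p s := by
  obtain ⟨n, hn, hmin, hk, hc⟩ := hp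
  obtain ⟨c, q, rfl, hq⟩ := exists_insert_greatest ⟨n, hn⟩
  have hcq : c ∉ q := fun h => lt_irrefl _ (hq c h)
  rw [Finset.card_insert_of_notMem hcq] at hc
  -- If `p = {n}`, the replacement moves the least element to `n + 1`, so the size becomes `a (n +
  -- 1) + 1`; otherwise the least element stays `n`.
  rcases q.eq_empty_or_nonempty with rfl | hne
  · have : n = c := by simpa using hn
    subst this
    refine ⟨_, ?_, ∅, n, n + 1 + a (n + 1), by simp, by omega, rfl, rfl⟩
    refine ⟨n + 1, by simp, by simp; omega, by omega, ?_⟩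
    simp
    omega
  · have hnq : n ∈ q := by
      rcases Finset.mem_insert.1 hn with rfl | h
      · obtain ⟨i, hi⟩ := hne
        exact absurd (hq i hi) (hmin i (by simp [hi])).not_gt
      · exact h
    have hnc := hq n hnq
    refine ⟨_, ?_, q, c, c + (a n + 1 - q.card), hq, by omega, rfl, rfl⟩
    refine ⟨n, by simp [hnq], ?_, hk, ?_⟩
    · intro i hi
      rcases Finset.mem_union.1 hi with h | h
      · exact hmin i (by simp [h])
      · rw [Finset.mem_Icc] at h
        omega
    · rw [Finset.card_union_of_disjoint, Nat.card_Icc]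
      · omega
      · rw [Finset.disjoint_left]
        intro i hi hi'
        have := hq i hi
        rw [Finset.mem_Icc] at hi'
        omega

theorem IsLexSup.lexLT {p s : Finset ℕ} (h : IsLexSup p s) : LexLT p s := by
  obtain ⟨q, c, m, hq, hcm, rfl, rfl⟩ := h
  refine ⟨c, by simp, ?_, ?_⟩
  · have : c ∉ q := fun h => lt_irrefl _ (hq c h)
    simp [this]
  · intro j hj
    simp only [Finset.mem_insert, Finset.mem_union, Finset.mem_Icc]
    have : j ≠ c := hj.ne
    have : ¬ (c + 1 ≤ j) := by omega
    tauto

/-- Let `x ∈ p` witness `p < u`. If `x = c`, then `s` and `u` agree through `c` and `s` continues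
with an interval, the least possible continuation; if `x < c`, then `x` also witnesses `s < u`. -/
theorem IsLexSup.eq_or_lexLT {k : ℕ} {a : ℕ → ℕ} {p s u : Finset ℕ} (h : IsLexSup p s)
    (hs : s ∈ omegaFamily k a) (hu : u ∈ omegaFamily k a) (hpu : LexLT p u) :
    s = u ∨ LexLT s u := by
  obtain ⟨q, c, m, hq, hcm, rfl, rfl⟩ := h
  obtain ⟨x, hxp, hxu, hx⟩ := hpu
  have hlow : ∀ j < c, (j ∈ q ∪ Finset.Icc (c + 1) m ↔ j ∈ insert c q) := by
    intro j hj
    simp only [Finset.mem_insert, Finset.mem_union, Finset.mem_Icc]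
    have : j ≠ c := hj.ne
    have : ¬ (c + 1 ≤ j) := by omega
    tauto
  rcases Finset.mem_insert.1 hxp with rfl | hxq
  · refine eq_or_lexLT_of_interval (b := x + 1) (m := m) hs hu ?_ ?_
    · intro j hj
      rcases Nat.lt_succ_iff_lt_or_eq.1 hj with hj | rfl
      · exact (hlow j hj).trans (hx j hj)
      · have : j ∉ q := fun h => lt_irrefl _ (hq j h)
        simp [this, hxu]
    · intro j hj
      have : j ∉ q := fun h => by have := hq j h; omega
      simp [this]
      omega
  · right
    have hxc := hq x hxq
    exact ⟨x, by simp [hxq], hxu, fun j hj => (hlow j (hj.trans hxc)).trans (hx j hj)⟩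

theorem IsLexSup.le_of_lt {k : ℕ} {a : ℕ → ℕ} {p s u : Finset ℕ} (h : IsLexSup p s)
    (hs : s ∈ omegaFamily k a) (hu : u ∈ omegaFamily k a) (hus : LexLT u s) :
    u = p ∨ LexLT u p := by
  rcases LexLT.trichotomy u p with h1 | h1 | h1
  · exact Or.inr h1
  · exact Or.inl h1
  · rcases h.eq_or_lexLT hs hu h1 with rfl | h2
    · exact absurd hus (LexLT.irrefl _)
    · exact absurd hus h2.not_gt

theorem IsLexSup.right_unique {k : ℕ} {a : ℕ → ℕ} {p s t : Finset ℕ} (hs : IsLexSup p s)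
    (ht : IsLexSup p t) (hs' : s ∈ omegaFamily k a) (ht' : t ∈ omegaFamily k a) : s = t := by
  rcases hs.eq_or_lexLT hs' ht' ht.lexLT with h | h
  · exact h
  rcases ht.eq_or_lexLT ht' hs' hs.lexLT with h' | h'
  · exact h'.symm
  · exact absurd h' h.not_gt

/-- The element `c` is recovered as the largest number below `max s` missing from `s`, and `q` as
the part of `s` below `c`. -/
theorem IsLexSup.left_unique {p p' s : Finset ℕ} (h : IsLexSup p s) (h' : IsLexSup p' s) :
    p = p' := by
  obtain ⟨q, c, m, hq, hcm, rfl, hs⟩ := h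
  obtain ⟨q', c', m', hq', hcm', rfl, hs'⟩ := h'
  have hmem : ∀ j, (j ∈ q ∨ c < j ∧ j ≤ m) ↔ (j ∈ q' ∨ c' < j ∧ j ≤ m') := by
    intro j
    have h1 : j ∈ q ∪ Finset.Icc (c + 1) m ↔ j ∈ q' ∪ Finset.Icc (c' + 1) m' := by
      rw [← hs, hs']
    simpa [Nat.succ_le_iff] using h1
  have hc : c ∉ q := fun h => lt_irrefl _ (hq c h)
  have hc' : c' ∉ q' := fun h => lt_irrefl _ (hq' c' h)
  have e1 := hmem c
  have e2 := hmem c'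
  have e3 := hmem m
  have e4 := hmem m'
  have b1 := hq c'
  have b2 := hq' c
  have b3 := hq m'
  have b4 := hq' m
  have hcc : c = c' := by
    rcases lt_trichotomy c c' with h | h | h
    · have : m' ≤ m := by
        rcases e4.2 (Or.inr ⟨hcm', le_rfl⟩) with h' | h'
        · have := b3 h'
          omega
        · exact h'.2
      rcases e2.1 (Or.inr ⟨h, by omega⟩) with h' | h'
      · exact absurd h' hc'
      · omega
    · exact h
    · have : m ≤ m' := by
        rcases e3.1 (Or.inr ⟨hcm, le_rfl⟩) with h' | h'
        · have := b4 h'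
          omega
        · exact h'.2
      rcases e1.2 (Or.inr ⟨h, by omega⟩) with h' | h'
      · exact absurd h' hc
      · omega
  subst hcc
  congr 1
  ext j
  constructor
  · intro hj
    rcases (hmem j).1 (Or.inl hj) with h | h
    · exact h
    · have := hq j hj
      omega
  · intro hj
    rcases (hmem j).2 (Or.inl hj) with h | h
    · exact h
    · have := hq' j hj
      omega

theorem IsLexSup.mono {k : ℕ} {a : ℕ → ℕ} {p p' s s' : Finset ℕ} (h : IsLexSup p s)
    (h' : IsLexSup p' s') (hs : s ∈ omegaFamily k a) (hs' : s' ∈ omegaFamily k a)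
    (hp : LexLT p p') : LexLT s s' := by
  rcases h.eq_or_lexLT hs hs' (hp.trans h'.lexLT) with rfl | h1
  · rw [h.left_unique h'] at hp
    exact absurd hp (LexLT.irrefl _)
  · exact h1

theorem IsLexSup.lexLT_iff {k : ℕ} {a : ℕ → ℕ} {p p' s s' : Finset ℕ} (h : IsLexSup p s)
    (h' : IsLexSup p' s') (hs : s ∈ omegaFamily k a) (hs' : s' ∈ omegaFamily k a) :
    LexLT s s' ↔ LexLT p p' := by
  refine ⟨fun hlt => ?_, h.mono h' hs hs'⟩
  rcases LexLT.trichotomy p p' with h1 | rfl | h1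
  · exact h1
  · rw [h.right_unique h' hs hs'] at hlt
    exact absurd hlt (LexLT.irrefl _)
  · exact absurd hlt (h'.mono h hs' hs h1).not_gt

/-- The largest gap of `s` in `[k, max s)` serves as the last element of `p`. Without a gap, `s` is
an interval starting at `k`, the least member of the family. -/
theorem exists_isLexSup_of_mem {k : ℕ} {a : ℕ → ℕ} {s : Finset ℕ} (hs : s ∈ omegaFamily k a) :
    (∃ p, IsNode k a p ∧ IsLexSup p s) ∨ ∃ m, s = Finset.Icc k m := by
  classical
  obtain ⟨n, hn, hmin, hk, hc⟩ := hs
  obtain ⟨m, r, rfl, hr⟩ := exists_insert_greatest ⟨n, hn⟩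
  generalize hs : insert m r = s at *
  have hmax : ∀ i ∈ s, i ≤ m := by
    rw [← hs]
    intro i hi
    rcases Finset.mem_insert.1 hi with rfl | h
    · exact le_rfl
    · exact (hr i h).le
  have hms : m ∈ s := hs ▸ Finset.mem_insert_self m r
  set G := (Finset.Ico k m).filter (· ∉ s) with hG
  rcases G.eq_empty_or_nonempty with hGe | hGne
  · right
    refine ⟨m, Finset.ext fun i => ⟨fun hi => ?_, fun hi => ?_⟩⟩
    · exact Finset.mem_Icc.2 ⟨hk.trans (hmin i hi), hmax i hi⟩
    · rw [Finset.mem_Icc] at hi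
      rcases hi.2.lt_or_eq with h | rfl
      · by_contra his
        have : i ∈ G := Finset.mem_filter.2 ⟨Finset.mem_Ico.2 ⟨hi.1, h⟩, his⟩
        rw [hGe] at this
        simp at this
      · exact hms
  · left
    obtain ⟨c, C, hGC, hCc⟩ := exists_insert_greatest hGne
    have hcG : c ∈ G := hGC ▸ Finset.mem_insert_self c C
    obtain ⟨hcI, hcs⟩ := Finset.mem_filter.1 hcG
    rw [Finset.mem_Ico] at hcI
    have hfull : ∀ j, c < j → j ≤ m → j ∈ s := by
      intro j hcj hjm
      rcases hjm.lt_or_eq with h | rfl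
      · by_contra hjs
        have : j ∈ G := Finset.mem_filter.2 ⟨Finset.mem_Ico.2 ⟨by omega, h⟩, hjs⟩
        rw [hGC] at this
        rcases Finset.mem_insert.1 this with rfl | h'
        · omega
        · have := hCc j h'
          omega
      · exact hms
    have hqc : ∀ i ∈ s.filter (· < c), i < c := fun i hi => (Finset.mem_filter.1 hi).2
    refine ⟨insert c (s.filter (· < c)), ?_, s.filter (· < c), c, m, hqc, hcI.2, rfl, ?_⟩
    · have hcard : (insert c (s.filter (· < c))).card ≤ (s.filter (· < c)).card + 1 :=
        Finset.card_insert_le _ _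
      rcases (s.filter (· < c)).eq_empty_or_nonempty with he | ⟨i, hi⟩
      · rw [he]
        exact ⟨c, by simp, by simp, hcI.1, by simp⟩
      · have hi' := Finset.mem_filter.1 hi
        have hnc : n < c := (hmin i hi'.1).trans_lt hi'.2
        refine ⟨n, by simp [hn, hnc], ?_, hk, ?_⟩
        · intro j hj
          rcases Finset.mem_insert.1 hj with rfl | hj
          · exact hnc.le
          · exact hmin j (Finset.mem_filter.1 hj).1
        · have hlt : (s.filter (· < c)).card < s.card := by
            refine Finset.card_lt_card (Finset.filter_ssubset.2 ⟨m, hms, ?_⟩)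
            omega
          omega
    · ext i
      simp only [Finset.mem_union, Finset.mem_filter, Finset.mem_Icc]
      constructor
      · intro hi
        have h1 := hmax i hi
        have h2 : i ≠ c := fun h => hcs (h ▸ hi)
        by_cases h3 : i < c
        · exact Or.inl ⟨hi, h3⟩
        · exact Or.inr ⟨by omega, h1⟩
      · rintro (h | h)
        · exact h.1
        · exact hfull i (by omega) h.2

theorem eq_or_lexLT_of_Icc {k m : ℕ} {a : ℕ → ℕ} {u : Finset ℕ}
    (hs : Finset.Icc k m ∈ omegaFamily k a) (hu : u ∈ omegaFamily k a) :
    Finset.Icc k m = u ∨ LexLT (Finset.Icc k m) u := by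
  refine eq_or_lexLT_of_interval (b := k) (m := m) hs hu ?_ ?_
  · intro j hj
    obtain ⟨n, -, h, hk, -⟩ := hu
    have : j ∉ u := fun hju => by have := h j hju; omega
    simp only [Finset.mem_Icc, this, iff_false]
    omega
  · intro j hj
    simp [hj]

/-- The members of the family below the supremum of those extending `p` are eventually below the
suprema of those extending `p ∪ {i}`. -/
theorem IsLexSup.exists_forall_lexLT {k : ℕ} {a : ℕ → ℕ} {p s u : Finset ℕ} (h : IsLexSup p s)
    (hs : s ∈ omegaFamily k a) (hp : p ∉ omegaFamily k a) (hu : u ∈ omegaFamily k a)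
    (hus : LexLT u s) :
    ∃ R, ∀ i, R ≤ i → ∀ w, IsLexSup (insert i p) w → LexLT u w := by
  have hup : LexLT u p := by
    rcases h.le_of_lt hs hu hus with rfl | h'
    · exact absurd hu hp
    · exact h'
  obtain ⟨x, hxu, hxp, hx⟩ := hup
  refine ⟨max x (p.sup id + 1), fun i hi w hw => ?_⟩
  have hpi : ∀ j ∈ p, j < i := fun j hj => by
    have : j ≤ p.sup id := Finset.le_sup (f := id) hj
    omega
  obtain ⟨q, c, m, hq, hcm, he, rfl⟩ := hw
  obtain ⟨rfl, rfl⟩ := insert_greatest_inj hpi hq he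
  refine ⟨x, hxu, ?_, fun j hj => ?_⟩
  · simp only [Finset.mem_union, hxp, Finset.mem_Icc, false_or]
    omega
  · rw [hx j hj]
    simp only [Finset.mem_union, Finset.mem_Icc]
    have : ¬ (i + 1 ≤ j) := by omega
    tauto

theorem lexLT_insert {p : Finset ℕ} {i : ℕ} (hi : i ∉ p) : LexLT (insert i p) p := by
  refine ⟨i, by simp, hi, fun j hj => ?_⟩
  simp [hj.ne]

open Filter Topology

theorem mem_omegaFamily_iff {k : ℕ} {a : ℕ → ℕ} {p : Finset ℕ} {n : ℕ} (hn : n ∈ p)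
    (hmin : ∀ i ∈ p, n ≤ i) : p ∈ omegaFamily k a ↔ k ≤ n ∧ p.card = a n + 1 := by
  constructor
  · rintro ⟨l, hl, hl', hk, hc⟩
    obtain rfl : l = n := le_antisymm (hl' n hn) (hmin l hl)
    exact ⟨hk, hc⟩
  · rintro ⟨hk, hc⟩
    exact ⟨n, hn, hmin, hk, hc⟩

-- Derivatives: a copy forces long intervals

/-- The finite Cantor–Bendixson derivatives of a space. -/
def iterDerived (X : Type*) [TopologicalSpace X] : ℕ → Set X
  | 0 => univ
  | j + 1 => derivedSet (iterDerived X j)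

theorem map_mem_iterDerived {X Y : Type*} [TopologicalSpace X] [TopologicalSpace Y] {f : X → Y}
    (hf : Continuous f) (hinj : Function.Injective f) {j : ℕ} {x : X}
    (hx : x ∈ iterDerived X j) : f x ∈ iterDerived Y j := by
  induction j generalizing x with
  | zero => trivial
  | succ j ih =>
    refine accPt_iff_nhds.2 fun U hU => ?_
    obtain ⟨y, ⟨hyU, hy⟩, hne⟩ := accPt_iff_nhds.1 hx _ (hf.continuousAt hU)
    exact ⟨f y, ⟨hyU, ih hy⟩, hinj.ne hne⟩

/-- A member is itself a node, and its supremum is its immediate successor. Only approach from below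
matters for limits. -/
theorem Iic_mem_nhds {k : ℕ} {a : ℕ → ℕ} (s : Space (omegaFamily k a)) : Iic s ∈ 𝓝 s := by
  obtain ⟨t, ht, hst⟩ := (isNode_of_mem s.2).exists_isLexSup
  have h : s < (⟨t, ht⟩ : Space (omegaFamily k a)) := hst.lexLT
  filter_upwards [Iio_mem_nhds h] with u hu
  rcases hst.le_of_lt ht u.2 hu with h | h
  · exact Or.inl (Subtype.ext h)
  · exact Or.inr h

/-- If `p` lacks at least `j + 1` elements, the suprema of `p ∪ {i}` lie in the `j`-th derivative by
induction and converge to `s` from below. -/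
theorem mem_iterDerived_of_isLexSup {k : ℕ} {a : ℕ → ℕ} {j n : ℕ} {p : Finset ℕ}
    {s : Space (omegaFamily k a)} (hn : n ∈ p) (hmin : ∀ i ∈ p, n ≤ i) (hk : k ≤ n)
    (hc : p.card + j ≤ a n + 1) (h : IsLexSup p s.1) :
    s ∈ iterDerived (Space (omegaFamily k a)) j := by
  induction j generalizing p s with
  | zero => trivial
  | succ j ih =>
    have hp : p ∉ omegaFamily k a := fun h => by
      have := ((mem_omegaFamily_iff hn hmin).1 h).2
      omega
    have hchild : ∀ R, ∃ i, R ≤ i ∧ ∃ t : Space (omegaFamily k a),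
        IsLexSup (insert i p) t.1 ∧ t < s ∧ t ∈ iterDerived (Space (omegaFamily k a)) j := by
      intro R
      have hi : ∀ l ∈ p, l < max R (p.sup id + 1) := fun l hl => by
        have : l ≤ p.sup id := Finset.le_sup (f := id) hl
        omega
      generalize hm : max R (p.sup id + 1) = i at hi
      have hip : i ∉ p := fun h => lt_irrefl _ (hi i h)
      have hmin' : ∀ l ∈ insert i p, n ≤ l := by
        intro l hl
        rcases Finset.mem_insert.1 hl with rfl | hl
        · exact (hi n hn).le
        · exact hmin l hl
      have hcard := Finset.card_insert_of_notMem hip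
      have hnode : IsNode k a (insert i p) := ⟨n, by simp [hn], hmin', hk, by omega⟩
      obtain ⟨t, ht, hpt⟩ := hnode.exists_isLexSup
      exact ⟨i, by omega, ⟨t, ht⟩, hpt, hpt.mono h ht s.2 (lexLT_insert hip),
        ih (Finset.mem_insert_of_mem hn) hmin' (by omega) hpt⟩
    refine accPt_iff_nhds.2 fun U hU => ?_
    obtain ⟨-, -, t₀, -, ht₀, -⟩ := hchild 0
    obtain ⟨u, hu, huU⟩ := exists_Ioc_subset_of_mem_nhds hU ⟨t₀, ht₀⟩
    obtain ⟨R, hR⟩ := h.exists_forall_lexLT s.2 hp u.2 hu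
    obtain ⟨i, hi, t, hpt, hts, htD⟩ := hchild R
    exact ⟨t, ⟨huU ⟨hR i hi t.1 hpt, hts.le⟩, htD⟩, hts.ne⟩

theorem iterDerived_nonempty {k : ℕ} {a : ℕ → ℕ} (ha : StrictMonoOn a (Ici k)) (j : ℕ) :
    (iterDerived (Space (omegaFamily k a)) j).Nonempty := by
  have key : j ≤ a (k + j) := by
    induction j with
    | zero => exact Nat.zero_le _
    | succ j ih =>
      exact ih.trans_lt (ha (mem_Ici.2 (by omega)) (mem_Ici.2 (by omega)) (by omega))
  have hnode : IsNode k a {k + j} := ⟨k + j, by simp, by simp, by omega, by simp⟩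
  obtain ⟨s, hs, h⟩ := hnode.exists_isLexSup
  exact ⟨⟨s, hs⟩, mem_iterDerived_of_isLexSup (n := k + j) (by simp) (by simp) (by omega)
    (by simp; omega) h⟩

/-- Points of the `j`-th derivative close below `s` end-extend `p` and finish with `j + 1`
consecutive numbers beyond `p`. So `p` lacks at least `j + 1` elements, and the interval replacing
`max p` in `s` has length at least `j + 2`. -/
theorem exists_Icc_subset_of_mem_iterDerived {k : ℕ} {a : ℕ → ℕ} (ha : StrictMonoOn a (Ici k))
    {j : ℕ} {s : Space (omegaFamily k a)} (hs : s ∈ iterDerived (Space (omegaFamily k a)) j) :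
    ∃ b, Finset.Icc b (b + j) ⊆ s.1 ∧ ∀ i ∈ s.1, i ≤ b + j := by
  induction j generalizing s with
  | zero =>
    obtain ⟨n, hn, -⟩ := s.2
    refine ⟨s.1.max' ⟨n, hn⟩, ?_, fun i hi => s.1.le_max' i hi⟩
    simpa using s.1.max'_mem ⟨n, hn⟩
  | succ j ih =>
    have hacc := accPt_iff_nhds.1 hs
    rcases exists_isLexSup_of_mem s.2 with ⟨p, hp, hps⟩ | ⟨m, hm⟩
    · have hps' := hps
      obtain ⟨q, c, m, hq, hcm, rfl, hsq⟩ := hps'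
      obtain ⟨n, hn, hmin, hk, hc⟩ := hp
      have hcq : c ∉ q := fun h => lt_irrefl _ (hq c h)
      have hnc : n ≤ c := hmin c (by simp)
      by_cases hpF : insert c q ∈ omegaFamily k a
      -- Here `p` is the immediate predecessor of `s`, so `s` is isolated.
      · exfalso
        let v₀ : Space (omegaFamily k a) := ⟨insert c q, hpF⟩
        have hlt : v₀ < s := hps.lexLT
        obtain ⟨t, ⟨⟨ht1, ht2⟩, -⟩, hne⟩ :=
          hacc _ (inter_mem (Ioi_mem_nhds hlt) (Iic_mem_nhds s))
        have ht1' : LexLT (insert c q) t.1 := ht1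
        rcases hps.le_of_lt s.2 t.2 (lt_of_le_of_ne ht2 hne) with h | h
        · rw [h] at ht1'
          exact LexLT.irrefl _ ht1'
        · exact ht1'.not_gt h
      · have hpc : ∀ i ∈ insert c q, i < c + 1 := by
          intro i hi
          rcases Finset.mem_insert.1 hi with rfl | h
          · omega
          · have := hq i h
            omega
        have hcard : (insert c q).card < a n + 1 := by
          refine lt_of_le_of_ne hc fun h => hpF ((mem_omegaFamily_iff hn hmin).2 ⟨hk, h⟩)
        have hcp : c + 1 ∉ insert c q := fun h => lt_irrefl _ (hpc _ h)
        have hnode : IsNode k a (insert (c + 1) (insert c q)) := by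
          refine ⟨n, Finset.mem_insert_of_mem hn, ?_, hk, ?_⟩
          · intro i hi
            rcases Finset.mem_insert.1 hi with rfl | h
            · omega
            · exact hmin i h
          · rw [Finset.card_insert_of_notMem hcp]
            omega
        -- Points between the supremum of `p ∪ {c + 1}` and `s` extend `p` and skip `c + 1`, which
        -- separates their final interval from `p`.
        obtain ⟨u, hu, hpu⟩ := hnode.exists_isLexSup
        let v₀ : Space (omegaFamily k a) := ⟨u, hu⟩
        have hus : v₀ < s :=
          hpu.mono hps hu s.2 (lexLT_insert hcp)
        obtain ⟨t, ⟨⟨ht1, ht2⟩, htD⟩, hne⟩ :=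
          hacc _ (inter_mem (Ioi_mem_nhds hus) (Iic_mem_nhds s))
        have ht1' : LexLT u t.1 := ht1
        obtain ⟨x, hxt, hxp, hx⟩ : LexLT t.1 (insert c q) := by
          rcases hps.le_of_lt s.2 t.2 (lt_of_le_of_ne ht2 hne) with h | h
          · exact absurd (h ▸ t.2) hpF
          · exact h
        have hxc : c + 1 < x := by
          by_contra hxc
          obtain ⟨q', c', m', hq', -, he, rfl⟩ := hpu
          obtain ⟨rfl, rfl⟩ := insert_greatest_inj hpc hq' he
          refine ht1'.not_gt ?_
          refine ⟨x, hxt, ?_, fun j hj => ?_⟩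
          · simp only [Finset.mem_union, hxp, Finset.mem_Icc, false_or]
            omega
          · rw [hx j hj, Finset.mem_union, Finset.mem_Icc]
            have : ¬ (c + 1 + 1 ≤ j) := by omega
            tauto
        obtain ⟨b, hbt, hb⟩ := ih htD
        have hbc : c + 1 < b := by
          by_contra hbc
          have h1 : c + 1 ∈ t.1 := hbt (Finset.mem_Icc.2 ⟨by omega, by have := hb x hxt; omega⟩)
          exact hcp ((hx _ hxc).1 h1)
        have hnt : n ∈ t.1 := (hx n (by omega)).2 hn
        have hmint : ∀ i ∈ t.1, n ≤ i := by
          intro i hi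
          rcases lt_or_ge i x with h | h
          · exact hmin i ((hx i h).1 hi)
          · omega
        have hct := ((mem_omegaFamily_iff hnt hmint).1 t.2).2
        have hdisj : Disjoint (insert c q) (Finset.Icc b (b + j)) := by
          rw [Finset.disjoint_left]
          intro i hi hi'
          have := hpc i hi
          rw [Finset.mem_Icc] at hi'
          omega
        have hle : (insert c q ∪ Finset.Icc b (b + j)).card ≤ t.1.card := by
          refine Finset.card_le_card (Finset.union_subset (fun i hi => ?_) hbt)
          have := hpc i hi
          exact (hx i (by omega)).2 hi
        rw [Finset.card_union_of_disjoint hdisj, Finset.card_insert_of_notMem hcq,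
          Nat.card_Icc] at hle
        have hcs : s.1.card = q.card + (m - c) := by
          rw [hsq, Finset.card_union_of_disjoint, Nat.card_Icc]
          · omega
          · rw [Finset.disjoint_left]
            intro i hi hi'
            have := hq i hi
            rw [Finset.mem_Icc] at hi'
            omega
        have hlen : j + 2 ≤ m - c := by
          -- If `q` is empty the least element rises from `c` to `c + 1`; monotonicity of `a` only
          -- lengthens the interval.
          rcases q.eq_empty_or_nonempty with rfl | ⟨i, hi⟩
          · have hnc' : n = c := by simpa using hn
            have h1 : c + 1 ∈ s.1 := by rw [hsq]; simp; omega
            have h2 : ∀ i ∈ s.1, c + 1 ≤ i := by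
              rw [hsq]
              intro i hi
              simp at hi
              omega
            have h3 := ((mem_omegaFamily_iff h1 h2).1 s.2).2
            have h4 : a c < a (c + 1) :=
              ha (mem_Ici.2 (by omega)) (mem_Ici.2 (by omega)) (by omega)
            subst hnc'
            simp only [Finset.card_empty] at *
            omega
          · have hnq : n ∈ q := by
              rcases Finset.mem_insert.1 hn with rfl | h
              · exact absurd (hq i hi) (hmin i (by simp [hi])).not_gt
              · exact h
            have h1 : n ∈ s.1 := by rw [hsq]; simp [hnq]
            have h2 : ∀ i ∈ s.1, n ≤ i := by
              rw [hsq]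
              intro i hi
              rcases Finset.mem_union.1 hi with h | h
              · exact hmin i (by simp [h])
              · rw [Finset.mem_Icc] at h
                omega
            have h3 := ((mem_omegaFamily_iff h1 h2).1 s.2).2
            omega
        refine ⟨m - (j + 1), ?_, ?_⟩
        · intro i hi
          rw [Finset.mem_Icc] at hi
          rw [hsq, Finset.mem_union, Finset.mem_Icc]
          right
          omega
        · intro i hi
          rw [hsq, Finset.mem_union, Finset.mem_Icc] at hi
          rcases hi with h | h
          · have := hq i h
            omega
          · omega
    · exfalso
      obtain ⟨t, ⟨ht, -⟩, hne⟩ := hacc _ (Iic_mem_nhds s)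
      have hsF := s.2
      rw [hm] at hsF
      rcases eq_or_lexLT_of_Icc hsF t.2 with h | h
      · exact hne (Subtype.ext (by rw [hm, h]))
      · rw [← hm] at h
        exact (lt_of_le_of_ne ht hne).not_gt h

theorem ContainsCopy.hasLongIntervals {k : ℕ} {a : ℕ → ℕ} (ha : StrictMonoOn a (Ici k))
    {M : Set ℕ} (h : ContainsCopy (omegaFamily k a) M) : HasLongIntervals M := by
  obtain ⟨X, hX, ⟨e⟩⟩ := h
  intro l
  obtain ⟨x, hx⟩ := iterDerived_nonempty ha l
  have hy := map_mem_iterDerived (continuous_subtype_val.comp e.continuous)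
    (Subtype.val_injective.comp e.injective) hx
  obtain ⟨b, hb, -⟩ := exists_Icc_subset_of_mem_iterDerived ha hy
  exact ⟨b, fun i hi => hX (e x).2 (hb (Finset.mem_Icc.2 ⟨by omega, by omega⟩))⟩

-- Embeddings from node maps: long intervals give a copy

theorem isEmbedding_of_strictMono {X Y : Type*} [LinearOrder X] [TopologicalSpace X]
    [OrderTopology X] [LinearOrder Y] [TopologicalSpace Y] [OrderTopology Y] {f : X → Y}
    (hf : StrictMono f) (hc : Continuous f) : IsEmbedding f := by
  refine ⟨⟨le_antisymm (continuous_iff_le_induced.1 hc) ?_⟩, hf.injective⟩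
  rw [OrderTopology.topology_eq_generate_intervals (α := X)]
  refine le_generateFrom ?_
  rintro s ⟨x, rfl | rfl⟩
  · exact ⟨Ioi (f x), isOpen_Ioi, by ext y; simp [hf.lt_iff_lt]⟩
  · exact ⟨Iio (f x), isOpen_Iio, by ext y; simp [hf.lt_iff_lt]⟩

/-- A map of nodes that respects the lexicographic order and suprema induces an embedding of the
family into itself. -/
theorem exists_isEmbedding_of_nodeMap {k : ℕ} {a : ℕ → ℕ} (g : Finset ℕ → Finset ℕ)
    (s₀ : Space (omegaFamily k a))
    (hnode : ∀ p, IsNode k a p → IsNode k a (g p))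
    (hmono : ∀ p p', IsNode k a p → IsNode k a p' → LexLT p p' → LexLT (g p) (g p'))
    (hnot : ∀ p, IsNode k a p → p ∉ omegaFamily k a → g p ∉ omegaFamily k a)
    (hchild : ∀ p, IsNode k a p → p ∉ omegaFamily k a → ∀ R, ∃ i, i ∉ p ∧
      IsNode k a (insert i p) ∧ ∃ i', R ≤ i' ∧ g (insert i p) = insert i' (g p))
    (hbot : ∀ p, IsNode k a p → LexLT s₀.1 (g p)) :
    ∃ e : Space (omegaFamily k a) → Space (omegaFamily k a), IsEmbedding e ∧
      ∀ s, e s = s₀ ∨ ∃ p, IsNode k a p ∧ IsLexSup (g p) (e s).1 := by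
  have hex : ∀ s : Space (omegaFamily k a), ∃ t : Space (omegaFamily k a),
      (∀ p, IsNode k a p → IsLexSup p s.1 → IsLexSup (g p) t.1) ∧
      ((∃ p, IsNode k a p ∧ IsLexSup p s.1) ∨ t = s₀) := by
    intro s
    by_cases h : ∃ p, IsNode k a p ∧ IsLexSup p s.1
    · obtain ⟨p, hp, hps⟩ := h
      obtain ⟨t, ht, hpt⟩ := (hnode p hp).exists_isLexSup
      refine ⟨⟨t, ht⟩, fun p' _ hp's => ?_, Or.inl ⟨p, hp, hps⟩⟩
      rwa [hp's.left_unique hps]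
    · exact ⟨s₀, fun p hp hps => absurd ⟨p, hp, hps⟩ h, Or.inr rfl⟩
  choose e he hes using hex
  have hleast : ∀ s : Space (omegaFamily k a), (¬ ∃ p, IsNode k a p ∧ IsLexSup p s.1) →
      ∀ t, s ≤ t := by
    intro s hs t
    rcases exists_isLexSup_of_mem s.2 with h | ⟨m, hm⟩
    · exact absurd h hs
    · have hsF := s.2
      rw [hm] at hsF
      rcases eq_or_lexLT_of_Icc hsF t.2 with h | h
      · exact Or.inl (Subtype.ext (by rw [hm, h]))
      · exact Or.inr (by rwa [hm])
  have hstrict : StrictMono e := by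
    intro s t hst
    by_cases ht : ∃ p, IsNode k a p ∧ IsLexSup p t.1
    · obtain ⟨p', hp', hpt⟩ := ht
      rcases hes s with ⟨p, hp, hps⟩ | h
      · exact (he s p hp hps).mono (he t p' hp' hpt) (e s).2 (e t).2
          (hmono p p' hp hp' ((hps.lexLT_iff hpt s.2 t.2).1 hst))
      · rw [h]
        exact (hbot p' hp').trans (he t p' hp' hpt).lexLT
    · exact absurd hst (hleast t ht s).not_gt
  have hcont : Continuous e := by
    refine OrderTopology.continuous_iff.2 fun u => ⟨?_, ?_⟩
    · rw [isOpen_iff_mem_nhds]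
      intro s hus
      have hus : u < e s := hus
      by_cases h : ∃ p, IsNode k a p ∧ IsLexSup p s.1
      · obtain ⟨p, hp, hps⟩ := h
        by_cases hpF : p ∈ omegaFamily k a
        · let v₀ : Space (omegaFamily k a) := ⟨p, hpF⟩
          have hlt : v₀ < s := hps.lexLT
          filter_upwards [Ioi_mem_nhds hlt] with t ht
          refine hus.trans_le (hstrict.monotone ?_)
          rcases hps.eq_or_lexLT s.2 t.2 ht with h | h
          · exact Or.inl (Subtype.ext h)
          · exact Or.inr h
        -- Suprema of children of `g p` approach `e s`, and infinitely many of them come from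
        -- children of `p`; one beyond `u` bounds a neighbourhood of `s`.
        · obtain ⟨R, hR⟩ := (he s p hp hps).exists_forall_lexLT (e s).2 (hnot p hp hpF) u.2 hus
          obtain ⟨i, hip, hi, i', hi', hgi⟩ := hchild p hp hpF R
          obtain ⟨t, ht, hit⟩ := hi.exists_isLexSup
          let v₀ : Space (omegaFamily k a) := ⟨t, ht⟩
          have hts : v₀ < s := hit.mono hps ht s.2 (lexLT_insert hip)
          have hut : u < e ⟨t, ht⟩ := by
            refine hR i' hi' _ ?_
            rw [← hgi]
            exact he _ _ hi hit
          filter_upwards [Ioi_mem_nhds hts] with v hv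
          exact hut.trans (hstrict hv)
      · filter_upwards with t
        exact hus.trans_le (hstrict.monotone (hleast s h t))
    · rw [isOpen_iff_mem_nhds]
      intro s hsu
      filter_upwards [Iic_mem_nhds s] with t ht
      exact (hstrict.monotone ht).trans_lt hsu
  refine ⟨e, isEmbedding_of_strictMono hstrict hcont, fun s => ?_⟩
  rcases hes s with ⟨p, hp, hps⟩ | h
  · exact Or.inr ⟨p, hp, he s p hp hps⟩
  · exact Or.inl h

/-- The node `Q n ∪ φ n '' p`, where `n` is the least element of `p`. -/
noncomputable def spread (Q : ℕ → Finset ℕ) (φ : ℕ → ℕ → ℕ) (p : Finset ℕ) : Finset ℕ :=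
  Q (sInf (p : Set ℕ)) ∪ p.image (φ (sInf (p : Set ℕ)))

theorem spread_eq {Q : ℕ → Finset ℕ} {φ : ℕ → ℕ → ℕ} {p : Finset ℕ} {n : ℕ} (hn : n ∈ p)
    (hmin : ∀ i ∈ p, n ≤ i) : spread Q φ p = Q n ∪ p.image (φ n) := by
  have h : IsLeast (p : Set ℕ) n := ⟨hn, fun i hi => hmin i hi⟩
  rw [spread, h.csInf_eq]

theorem LexLT.image {p p' : Finset ℕ} (h : LexLT p p') (q : Finset ℕ) {f : ℕ → ℕ}
    (hf : StrictMono f) (hq : ∀ i ∈ q, ∀ j, i < f j) :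
    LexLT (q ∪ p.image f) (q ∪ p'.image f) := by
  obtain ⟨x, hx, hx', h⟩ := h
  refine ⟨f x, ?_, ?_, fun j hj => ?_⟩
  · exact Finset.mem_union_right _ (Finset.mem_image_of_mem f hx)
  · rw [Finset.mem_union, hf.injective.mem_finset_image]
    rintro (h1 | h1)
    · exact lt_irrefl _ (hq _ h1 x)
    · exact hx' h1
  · simp only [Finset.mem_union, Finset.mem_image]
    refine or_congr_right ⟨?_, ?_⟩
    · rintro ⟨i, hi, rfl⟩
      exact ⟨i, (h i (hf.lt_iff_lt.1 hj)).1 hi, rfl⟩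
    · rintro ⟨i, hi, rfl⟩
      exact ⟨i, (h i (hf.lt_iff_lt.1 hj)).2 hi, rfl⟩

theorem lexLT_of_least_lt {s t : Finset ℕ} {n m : ℕ} (hn : n ∈ s) (hs : ∀ i ∈ s, n ≤ i)
    (ht : ∀ i ∈ t, m ≤ i) (h : n < m) : LexLT s t := by
  refine ⟨n, hn, fun hnt => (ht n hnt).not_gt h, fun j hj => ⟨fun h' => ?_, fun h' => ?_⟩⟩
  · exact absurd hj (hs j h').not_gt
  · have := ht j h'
    omega

/-- The padding `Q n` absorbs the difference between `a (ν n)` and `a n`, so that `p` and its image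
lack equally many elements. It also fixes the least element `ν n`, which taking suprema then cannot
move. Each value of `φ n` starts an interval of `M` of length `a n + 2`. -/
theorem exists_spread_data {k : ℕ} {a : ℕ → ℕ} (ha : StrictMonoOn a (Ici k)) {M : Set ℕ}
    (hM : HasLongIntervals M) :
    ∃ (Q : ℕ → Finset ℕ) (ν : ℕ → ℕ) (φ : ℕ → ℕ → ℕ) (s₀ : Space (omegaFamily k a)) (l : ℕ),
      StrictMono ν ∧ (s₀.1 : Set ℕ) ⊆ M ∧ l ∈ s₀.1 ∧ (∀ i ∈ s₀.1, l ≤ i) ∧ l < ν k ∧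
      ∀ n, k ≤ n → n < ν n ∧ ν n ∈ Q n ∧ (∀ i ∈ Q n, ν n ≤ i) ∧ (Q n : Set ℕ) ⊆ M ∧
        (Q n).card + a n = a (ν n) ∧ StrictMono (φ n) ∧ (∀ i ∈ Q n, ∀ j, i < φ n j) ∧
        ∀ j, ∀ i ≤ a n + 1, φ n j + i ∈ M := by
  have hinf : {i | i ∈ M}.Infinite := (hM.infinite_setOf 0).mono fun n hn => by
    exact hn 0 le_rfl
  have hinf' : ∀ d, {c | ∀ i ≤ d, c + i ∈ M}.Infinite := hM.infinite_setOf
  set N := Nat.nth (· ∈ M) with hN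
  have hNmono : StrictMono N := Nat.nth_strictMono hinf
  have hNM : ∀ i, N i ∈ M := fun i => Nat.nth_mem_of_infinite hinf i
  have hNle : ∀ i, i ≤ N i := fun _ => hNmono.le_apply
  -- With `N` enumerating `M`, `Q n` is a block of consecutive elements of `M` from `N (n + 1)`; the
  -- shift in `φ n` puts its values above that block. Starting at `N (n + 1)` leaves `N k` free for
  -- the bottom point `s₀`.
  refine ⟨fun n => (Finset.Ico (n + 1) (n + 1 + (a (N (n + 1)) - a n))).image N,
    fun n => N (n + 1),
    fun n i => Nat.nth (fun c => ∀ i ≤ a n + 1, c + i ∈ M)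
      (N (n + 1 + (a (N (n + 1)) - a n)) + i),
    ⟨(Finset.Ico k (k + (a (N k) + 1))).image N, N k, ?_, ?_, hNle k, ?_⟩, N k, ?_, ?_, ?_, ?_, ?_, ?_⟩
  · exact Finset.mem_image_of_mem _ (by simp)
  · intro i hi
    obtain ⟨j, hj, rfl⟩ := Finset.mem_image.1 hi
    exact hNmono.monotone (Finset.mem_Ico.1 hj).1
  · rw [Finset.card_image_of_injective _ hNmono.injective, Nat.card_Ico]
    omega
  · exact fun i j hij => hNmono (by omega)
  · intro i hi
    obtain ⟨j, -, rfl⟩ := Finset.mem_image.1 hi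
    exact hNM j
  · exact Finset.mem_image_of_mem _ (by simp)
  · intro i hi
    obtain ⟨j, hj, rfl⟩ := Finset.mem_image.1 hi
    exact hNmono.monotone (Finset.mem_Ico.1 hj).1
  · exact hNmono (Nat.lt_succ_self k)
  · intro n hn
    have h1 : n + 1 ≤ N (n + 1) := hNle _
    have h2 : a n < a (N (n + 1)) := ha (mem_Ici.2 hn) (mem_Ici.2 (by omega)) (by omega)
    have hφ := Nat.nth_strictMono (hinf' (a n + 1))
    refine ⟨h1, Finset.mem_image_of_mem _ (by simp; omega), ?_, ?_, ?_, ?_, ?_, ?_⟩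
    · intro i hi
      obtain ⟨j, hj, rfl⟩ := Finset.mem_image.1 hi
      exact hNmono.monotone (Finset.mem_Ico.1 hj).1
    · intro i hi
      obtain ⟨j, -, rfl⟩ := Finset.mem_image.1 hi
      exact hNM j
    · rw [Finset.card_image_of_injective _ hNmono.injective, Nat.card_Ico]
      dsimp only
      omega
    · exact fun i j hij => hφ (by omega)
    · intro i hi j
      obtain ⟨l, hl, rfl⟩ := Finset.mem_image.1 hi
      calc N l < N (n + 1 + (a (N (n + 1)) - a n)) := hNmono (Finset.mem_Ico.1 hl).2
        _ ≤ N (n + 1 + (a (N (n + 1)) - a n)) + j := Nat.le_add_right _ _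
        _ ≤ _ := hφ.le_apply
    · intro j
      exact Nat.nth_mem_of_infinite (hinf' (a n + 1)) _

theorem HasLongIntervals.containsCopy {k : ℕ} {a : ℕ → ℕ} (ha : StrictMonoOn a (Ici k))
    {M : Set ℕ} (hM : HasLongIntervals M) : ContainsCopy (omegaFamily k a) M := by
  obtain ⟨Q, ν, φ, s₀, l, hν, hs₀, hl, hl', hlν, hQ⟩ := exists_spread_data ha hM
  have hleast : ∀ n, k ≤ n → ∀ p : Finset ℕ, ν n ∈ Q n ∪ p.image (φ n) ∧
      ∀ i ∈ Q n ∪ p.image (φ n), ν n ≤ i := by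
    intro n hn p
    obtain ⟨-, h1, h2, -, -, -, h3, -⟩ := hQ n hn
    refine ⟨Finset.mem_union_left _ h1, fun i hi => ?_⟩
    rcases Finset.mem_union.1 hi with h | h
    · exact h2 i h
    · obtain ⟨j, -, rfl⟩ := Finset.mem_image.1 h
      exact (h3 _ h1 j).le
  have hcard : ∀ n, k ≤ n → ∀ p : Finset ℕ,
      (Q n ∪ p.image (φ n)).card = (Q n).card + p.card := by
    intro n hn p
    obtain ⟨-, -, -, -, -, h4, h3, -⟩ := hQ n hn
    rw [Finset.card_union_of_disjoint, Finset.card_image_of_injective _ h4.injective]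
    rw [Finset.disjoint_left]
    intro i hi hi'
    obtain ⟨j, -, rfl⟩ := Finset.mem_image.1 hi'
    exact lt_irrefl _ (h3 _ hi j)
  have hnode : ∀ p, IsNode k a p → IsNode k a (spread Q φ p) := by
    rintro p ⟨n, hn, hmin, hk, hc⟩
    obtain ⟨hnν, -, -, -, hQc, -⟩ := hQ n hk
    rw [spread_eq hn hmin]
    refine ⟨ν n, (hleast n hk p).1, (hleast n hk p).2, by omega, ?_⟩
    rw [hcard n hk]
    omega
  have hmono : ∀ p p', IsNode k a p → IsNode k a p' → LexLT p p' →
      LexLT (spread Q φ p) (spread Q φ p') := by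
    rintro p p' ⟨n, hn, hmin, hk, hc⟩ ⟨n', hn', hmin', hk', hc'⟩ hpp'
    rw [spread_eq hn hmin, spread_eq hn' hmin']
    have hnn' : n ≤ n' := by
      by_contra hlt
      exact (lexLT_of_least_lt hn' hmin' hmin (by omega)).not_gt hpp'
    rcases hnn'.lt_or_eq with hlt | rfl
    · exact lexLT_of_least_lt (hleast n hk p).1 (hleast n hk p).2 (hleast n' hk' p').2 (hν hlt)
    · obtain ⟨-, -, -, -, -, h4, h3, -⟩ := hQ n hk
      exact hpp'.image _ h4 h3
  have hnot : ∀ p, IsNode k a p → p ∉ omegaFamily k a → spread Q φ p ∉ omegaFamily k a := by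
    rintro p ⟨n, hn, hmin, hk, hc⟩ hp hgp
    obtain ⟨hnν, -, -, -, hQc, -⟩ := hQ n hk
    rw [spread_eq hn hmin, mem_omegaFamily_iff (hleast n hk p).1 (hleast n hk p).2,
      hcard n hk] at hgp
    exact hp ((mem_omegaFamily_iff hn hmin).2 ⟨hk, by omega⟩)
  have hchild : ∀ p, IsNode k a p → p ∉ omegaFamily k a → ∀ R, ∃ i, i ∉ p ∧
      IsNode k a (insert i p) ∧ ∃ i', R ≤ i' ∧ spread Q φ (insert i p) = insert i' (spread Q φ p) := by
    rintro p ⟨n, hn, hmin, hk, hc⟩ hp R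
    obtain ⟨-, -, -, -, -, hφ, -, -⟩ := hQ n hk
    have hlt : p.card < a n + 1 :=
      lt_of_le_of_ne hc fun h => hp ((mem_omegaFamily_iff hn hmin).2 ⟨hk, h⟩)
    have hi : ∀ j ∈ p, j < max R (p.sup id + 1) := fun j hj => by
      have : j ≤ p.sup id := Finset.le_sup (f := id) hj
      omega
    generalize hm : max R (p.sup id + 1) = i at hi
    have hip : i ∉ p := fun h => lt_irrefl _ (hi i h)
    have hmin' : ∀ j ∈ insert i p, n ≤ j := by
      intro j hj
      rcases Finset.mem_insert.1 hj with rfl | hj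
      · exact (hi n hn).le
      · exact hmin j hj
    refine ⟨i, hip, ⟨n, Finset.mem_insert_of_mem hn, hmin', hk, ?_⟩, φ n i, ?_, ?_⟩
    · rw [Finset.card_insert_of_notMem hip]
      omega
    · exact le_trans (by omega) (hφ.le_apply (x := i))
    · rw [spread_eq hn hmin, spread_eq (Finset.mem_insert_of_mem hn) hmin', Finset.image_insert,
        Finset.union_insert]
  have hbot : ∀ p, IsNode k a p → LexLT s₀.1 (spread Q φ p) := by
    rintro p ⟨n, hn, hmin, hk, hc⟩
    rw [spread_eq hn hmin]
    exact lexLT_of_least_lt hl hl' (hleast n hk p).2 (hlν.trans_le (hν.monotone hk))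
  obtain ⟨e, he, hes⟩ := exists_isEmbedding_of_nodeMap (spread Q φ) s₀ hnode hmono
    hnot hchild hbot
  refine ⟨range e, ?_, ⟨he.toHomeomorph⟩⟩
  rintro _ ⟨s, rfl⟩
  rcases hes s with h | ⟨p, ⟨n, hn, hmin, hk, hc⟩, hps⟩
  · rw [h]
    exact hs₀
  obtain ⟨hnν, hνQ, hQν, hQM, hQc, hφ, hQφ, hφM⟩ := hQ n hk
  rw [spread_eq hn hmin] at hps
  generalize e s = t at hps
  obtain ⟨b, r, rfl, hr⟩ := exists_insert_greatest ⟨n, hn⟩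
  have hrQ : ∀ i ∈ Q n ∪ r.image (φ n), i < φ n b := by
    intro i hi
    rcases Finset.mem_union.1 hi with h | h
    · exact hQφ i h b
    · obtain ⟨j, hj, rfl⟩ := Finset.mem_image.1 h
      exact hφ (hr j hj)
  obtain ⟨q, c, m, hq, hcm, hins, hts⟩ := hps
  rw [Finset.image_insert, Finset.union_insert] at hins
  obtain ⟨rfl, rfl⟩ := insert_greatest_inj hrQ hq hins
  have htν : ν n ∈ t.1 := by
    rw [hts]
    exact Finset.mem_union_left _ (hleast n hk r).1
  have htν' : ∀ i ∈ t.1, ν n ≤ i := by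
    intro i hi
    rw [hts] at hi
    rcases Finset.mem_union.1 hi with h | h
    · exact (hleast n hk r).2 i h
    · rw [Finset.mem_Icc] at h
      have := hQφ _ hνQ b
      omega
  have htc := ((mem_omegaFamily_iff htν htν').1 t.2).2
  -- Counting gives `m - φ n b = a n + 1 - |r|`, so the new interval stays within the one of `M`
  -- starting at `φ n b`.
  rw [hts, Finset.card_union_of_disjoint, hcard n hk, Nat.card_Icc] at htc
  · intro i hi
    have hi : i ∈ t.1 := hi
    rw [hts, Finset.mem_union, Finset.mem_union, Finset.mem_image, Finset.mem_Icc] at hi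
    rcases hi with (h | ⟨j, -, rfl⟩) | h
    · exact hQM h
    · exact hφM j 0 (Nat.zero_le _)
    · have := hφM b (i - φ n b) (by omega)
      rwa [Nat.add_sub_cancel' (by omega)] at this
  · rw [Finset.disjoint_left]
    intro i hi hi'
    have := hrQ i hi
    rw [Finset.mem_Icc] at hi'
    omega

end UniformFamily

theorem mainTheorem3 :
    UniformFamily.IsUniform ω UniformFamily.schreierBarrier (Set.Ici 0) ∧
    ∀ (k : ℕ) (F : Set (Finset ℕ)), UniformFamily.IsUniform ω F (Set.Ici k) →
      ∀ M : Set ℕ, M.Infinite →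
        (UniformFamily.ContainsCopy F M ↔
          UniformFamily.IsAdequate ω F (Set.Ici k) M) ∧
        (UniformFamily.IsAdequate ω F (Set.Ici k) M ↔
          UniformFamily.HasLongIntervals M) := by
  refine ⟨?_, fun k F hF M _ => ?_⟩
  · rw [UniformFamily.schreierBarrier_eq]
    exact UniformFamily.isUniform_omegaFamily (strictMono_id.strictMonoOn _)
  · obtain ⟨a, ha, rfl⟩ := hF.exists_eq_omegaFamily
    have h : UniformFamily.IsAdequate ω (UniformFamily.omegaFamily k a) (Set.Ici k) M ↔
        UniformFamily.HasLongIntervals M :=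
      ⟨fun h => h.hasLongIntervals, fun h => h.isAdequate ha⟩
    exact ⟨⟨fun h' => h.2 (h'.hasLongIntervals ha), fun h' => (h.1 h').containsCopy ha⟩, h⟩
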